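/- Let $n,D\ge 0$ be integers and consider $n$ qubits at the vertices of an interaction graph $G$. A depth-$d$ circuit on $G$ is a sequence of $d$ layers; each layer is a tensor product of unitary gates acting on pairwise disjoint sets of qubits, each gate acting on two qubits that are adjacent in $G$ or on a single qubit (the remaining qubits are idle). The circuit complexity on $G$ of a state vector $|\psi\rangle$ is the minimum depth of a circuit $C$ on $G$ with $|\psi\rangle=C|0\rangle^{\otimes n}$. Let $|\psi\rangle$ have circuit complexity at most $D$ on $G$, and let $k$ be given by one of the following scenarios: 1. $k=2^D$, if the gates are not geometrically local ($G$ is the complete graph); 2. $k=2D$, if $D\ge 1$ and the qubits form a one-dimensional (open) chain, $G$ being the path on the $n$ qubits in order; 3. $k=\gamma_2(D)$, if the qubits sit on $n$ distinct sites of the square lattice $\mathbb{Z}^2$, two qubits being adjacent when their sites are nearest neighbours. Here $\gamma_2(D)$ is the largest cardinality of a set $S_D\subset\mathbb{Z}^2$ obtainable from $S_0=\{(0,0)\}$ in $D$ steps, where $S_j$ arises from $S_{j-1}$ by adding, for each $p\in S_{j-1}$, at most one nearest neighbour of $p$. Write $\psi=|\psi\rangle\langle\psi|$, let $\rho_s$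 denote the marginal (reduced density matrix) of $\rho$ on a set $s$ of qubits, and let $\|A\|_1=\operatorname{Tr}\sqrt{A^\dagger A}$. Then for every mixed state $\rho$ of the $n$ qubits (a positive semidefinite operator of trace one) and every real $\varepsilon>0$, at least one of the following holds: 1. $\|\psi-\rho\|_1<\varepsilon$; 2. $\|\psi_s-\rho_s\|_1>\dfrac{\varepsilon^2}{4n}$ for some set $s$ of exactly $\min(k,n)$ qubits. In particular, states of low circuit complexity are robustly determined, among all mixed states, by their $k$-qubit marginals. -/

import Mathlib

open scoped Kronecker Matrix ComplexOrder

noncomputable section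

/-- Labels of the computational basis of a register of qubits indexed by `ι`. -/
abbrev Bits (ι : Type) : Type := ι → Fin 2

/-- Operators on the state space of a register of qubits indexed by `ι`, as matrices in the
computational basis. -/
abbrev QOp (ι : Type) : Type := Matrix (Bits ι) (Bits ι) ℂ

/-- A mixed state: a positive semidefinite operator of trace one. -/
def IsDensity {ι : Type} [Fintype ι] [DecidableEq ι] (ρ : QOp ι) : Prop :=
  ρ.PosSemidef ∧ ρ.trace = 1

/-- The rank-one operator `|ψ⟩⟨ψ|`. -/
def ketBra {ι : Type} (ψ : Bits ι → ℂ) : QOp ι :=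
  Matrix.vecMulVec ψ (star ψ)

/-- The trace norm `‖A‖₁ = Tr √(A† A)`: the sum of the singular values of `A`, that is, of the
square roots of the eigenvalues (with multiplicity) of `A† A`. -/
def traceNorm {m : Type} [Fintype m] [DecidableEq m] (A : Matrix m m ℂ) : ℝ :=
  ∑ i, √((Matrix.isHermitian_conjTranspose_mul_self A).eigenvalues i)

/-- A basis label of the whole register is a pair: its bits inside `s` and its bits outside `s`. -/
def splitBits {n : ℕ} (s : Finset (Fin n)) :
    Bits (Fin n) ≃ Bits {i // i ∈ s} × Bits {i // i ∉ s} :=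
  Equiv.piEquivPiSubtypeProd (fun i => i ∈ s) (fun _ => Fin 2)

/-- The marginal (reduced density matrix) on the qubits in `s`: the partial trace over all the
other qubits. -/
def marginal {n : ℕ} (s : Finset (Fin n)) (ρ : QOp (Fin n)) : QOp {i // i ∈ s} :=
  fun x y => ∑ z : Bits {i // i ∉ s}, ρ ((splitBits s).symm (x, z)) ((splitBits s).symm (y, z))

/-- The operator `V ⊗ I` on the whole register, with `V` acting on the qubits in `s`. -/
def extendOp {n : ℕ} (s : Finset (Fin n)) (V : QOp {i // i ∈ s}) : QOp (Fin n) :=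
  (V ⊗ₖ (1 : QOp {i // i ∉ s})).submatrix (splitBits s) (splitBits s)

/-- A gate on the interaction graph `G`: a unitary acting either on two qubits that are adjacent
in `G`, or on a single qubit. -/
structure Gate {n : ℕ} (G : SimpleGraph (Fin n)) where
  support : Finset (Fin n)
  allowed : (∃ i j, G.Adj i j ∧ support = {i, j}) ∨ ∃ i, support = {i}
  V : QOp {i // i ∈ support}
  unitary : V ∈ Matrix.unitaryGroup (Bits {i // i ∈ support}) ℂ

/-- A layer: gates acting on pairwise disjoint sets of qubits. -/
structure Layer {n : ℕ} (G : SimpleGraph (Fin n)) where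
  gates : List (Gate G)
  disjoint : gates.Pairwise (fun g h => Disjoint g.support h.support)

/-- The unitary of a layer. The factors commute since their supports are disjoint, so that the
product is the tensor product of the gates (with the identity on the idle qubits). -/
def Layer.op {n : ℕ} {G : SimpleGraph (Fin n)} (L : Layer G) : QOp (Fin n) :=
  (L.gates.map (fun g => extendOp g.support g.V)).prod

/-- A circuit, as the list of its layers; the first layer of the list is applied first. -/
abbrev Circuit {n : ℕ} (G : SimpleGraph (Fin n)) : Type := List (Layer G)

/-- The depth of a circuit is its number of layers. -/
def Circuit.depth {n : ℕ} {G : SimpleGraph (Fin n)} (C : Circuit G) : ℕ := List.length C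

/-- The state `|0…0⟩`. -/
def ketZero (n : ℕ) : Bits (Fin n) → ℂ := Pi.single (fun _ => 0) 1

/-- The output state `U_D ⋯ U_1 |0…0⟩` of a circuit with layers `U_1, …, U_D`. -/
def Circuit.output {n : ℕ} {G : SimpleGraph (Fin n)} (C : Circuit G) : Bits (Fin n) → ℂ :=
  List.foldl (fun v L => L.op *ᵥ v) (ketZero n) C

/-- The circuit complexity of `ψ` on the interaction graph `G`: the minimum depth of a circuit
that outputs `ψ` (and `⊤` if there is no such circuit). -/
def circuitComplexity {n : ℕ} (G : SimpleGraph (Fin n)) (ψ : Bits (Fin n) → ℂ) : ℕ∞ :=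
  ⨅ (C : Circuit G) (_ : C.output = ψ), (C.depth : ℕ∞)

/-- The square lattice `ℤ²` with nearest-neighbour edges. -/
def squareLattice : SimpleGraph (ℤ × ℤ) where
  Adj p q := |p.1 - q.1| + |p.2 - q.2| = 1
  symm := ⟨fun p q h => by rw [abs_sub_comm q.1, abs_sub_comm q.2]; exact h⟩
  loopless := ⟨fun p h => by simp at h⟩

/-- `LatticeGrowth D S`: the set `S` can be obtained from `{(0, 0)}` in `D` steps, each of which
adds, for every point `p` already present, at most one lattice neighbour `f p` of `p`
(`f p = p` when nothing is added for `p`). -/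
inductive LatticeGrowth : ℕ → Finset (ℤ × ℤ) → Prop
  | zero : LatticeGrowth 0 {(0, 0)}
  | step {j : ℕ} {S : Finset (ℤ × ℤ)} (f : ℤ × ℤ → ℤ × ℤ)
      (hf : ∀ p ∈ S, f p = p ∨ squareLattice.Adj p (f p)) (hS : LatticeGrowth j S) :
      LatticeGrowth (j + 1) (S ∪ S.image f)

/-- `γ₂(D)`: the largest cardinality of a set obtained in `D` steps of lattice growth. -/
def gammaTwo (D : ℕ) : ℕ := sSup {m | ∃ S, LatticeGrowth D S ∧ S.card = m}

/-- The supremum in the definition of `gammaTwo` is a maximum. -/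
theorem gammaTwo_isGreatest (D : ℕ) :
    IsGreatest {m | ∃ S, LatticeGrowth D S ∧ S.card = m} (gammaTwo D) := by
  have hb : ∀ (D : ℕ) (S : Finset (ℤ × ℤ)), LatticeGrowth D S → S.card ≤ 2 ^ D := by
    intro D S h
    induction h with
    | zero => simp
    | @step j S f hf hS ih =>
      have h1 := Finset.card_union_le S (S.image f)
      have h2 : (S.image f).card ≤ S.card := Finset.card_image_le
      rw [pow_succ]
      omega
  have hne : ∀ D : ℕ, ∃ S, LatticeGrowth D S := by
    intro D
    induction D with
    | zero => exact ⟨_, LatticeGrowth.zero⟩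
    | succ j ih =>
      obtain ⟨S, hS⟩ := ih
      exact ⟨_, LatticeGrowth.step id (fun p _ => Or.inl rfl) hS⟩
  have hbdd : BddAbove {m | ∃ S, LatticeGrowth D S ∧ S.card = m} := by
    refine ⟨2 ^ D, ?_⟩
    rintro m ⟨S, hS, rfl⟩
    exact hb D S hS
  obtain ⟨S, hS⟩ := hne D
  exact ⟨Nat.sSup_mem ⟨S.card, S, hS, rfl⟩ hbdd, fun m hm => le_csSup hbdd hm⟩

end

open Matrix

/-!
A state `ψ = U |0…0⟩` is the unique ground state of the frustration-free Hamiltonian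
`H = ∑ i, (1 - W i) / 2`, where `W i = U Z_i U†` is the Pauli operator `Z_i` in the Heisenberg
picture. Since the ground state energy is `0` and the gap is `1`, the infidelity `1 - ⟨ψ|ρ|ψ⟩` is
at most `Tr (ρ H)` (`infidelity_le_sum`).

If `U` is a circuit of small depth, then `W i` acts only on the light cone of the qubit `i`
(`IsSupportedOn.conj_circuit`): every layer enlarges it by at most one neighbour of each qubit
already in it, namely the partner of that qubit in the layer. The size of the light cone is
therefore governed by a growth process on the interaction graph (`GraphGrowth`), which gives `2 ^ D`
on any graph, `2 * D` on a chain, and `gammaTwo D` on the square lattice.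

As `W i` is a unitary observable with `⟨ψ|W i|ψ⟩ = 1`, the energy `Tr (ρ (1 - W i))` is at most the
trace norm of the difference of the marginals of `ψ` and `ρ` on the light cone
(`norm_trace_unitary_mul_le_traceNorm`). If all of these are at most `ε² / (4 n)`, then the
infidelity is at most `ε² / 8`, and the Fuchs–van de Graaf inequality
`‖ψ - ρ‖₁² ≤ 4 (1 - ⟨ψ|ρ|ψ⟩)` (`sq_traceNorm_ketBra_sub_le`) yields `‖ψ - ρ‖₁² ≤ ε² / 2 < ε²`.
-/

/-! ### The trace norm of a Hermitian matrix -/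

/-- A Hermitian matrix can be diagonalized by a unitary matrix in such a way that its trace norm is
the sum of the absolute values of the diagonal entries. -/
theorem exists_diagonalization_traceNorm {m : Type} [Fintype m] [DecidableEq m]
    {A : Matrix m m ℂ} (hA : A.IsHermitian) :
    ∃ U ∈ unitaryGroup m ℂ, ∃ d : m → ℝ,
      A = U * diagonal (fun i => (d i : ℂ)) * Uᴴ ∧ traceNorm A = ∑ i, |d i| := by
  obtain ⟨U, hU, d, hd⟩ : ∃ U ∈ unitaryGroup m ℂ, ∃ d : m → ℝ,
      A = U * diagonal (fun i => (d i : ℂ)) * Uᴴ :=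
    ⟨hA.eigenvectorUnitary, hA.eigenvectorUnitary.2, hA.eigenvalues, hA.spectral_theorem⟩
  refine ⟨U, hU, d, hd, ?_⟩
  have hU1 : Uᴴ * U = 1 := mem_unitaryGroup_iff'.1 hU
  have hsq : Aᴴ * A = U * diagonal (fun i => ((d i ^ 2 : ℝ) : ℂ)) * Uᴴ := by
    rw [hA.eq, hd]
    calc U * diagonal (fun i => (d i : ℂ)) * Uᴴ * (U * diagonal (fun i => (d i : ℂ)) * Uᴴ)
        = U * diagonal (fun i => (d i : ℂ)) * (Uᴴ * U) * diagonal (fun i => (d i : ℂ)) * Uᴴ := by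
          simp only [Matrix.mul_assoc]
      _ = _ := by
          rw [hU1, Matrix.mul_one, Matrix.mul_assoc U, diagonal_mul_diagonal]
          congr 3
          ext i
          push_cast
          ring
  -- The squared singular values and the squares of the `d i` are the roots of one polynomial.
  have hroots := (isHermitian_conjTranspose_mul_self A).roots_charpoly_eq_eigenvalues
  have hchar : (Aᴴ * A).charpoly =
      ∏ i, (Polynomial.X - Polynomial.C ((d i ^ 2 : ℝ) : ℂ)) := by
    rw [hsq, charpoly_mul_comm, ← Matrix.mul_assoc, hU1, Matrix.one_mul, charpoly_diagonal]
  rw [hchar, Polynomial.roots_prod _ _ 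
    (Finset.prod_ne_zero_iff.2 fun i _ => Polynomial.X_sub_C_ne_zero _)] at hroots
  simp only [Polynomial.roots_X_sub_C, Multiset.bind_singleton] at hroots
  have h := congrArg (fun t : Multiset ℂ => (t.map (fun z => √z.re)).sum) hroots
  simp only [Multiset.map_map, Function.comp_def, Complex.ofReal_re, Real.sqrt_sq_eq_abs] at h
  exact h.symm

/-- Duality between the trace norm and unitary observables. -/
theorem norm_trace_unitary_mul_le_traceNorm {m : Type} [Fintype m] [DecidableEq m]
    {A W : Matrix m m ℂ} (hA : A.IsHermitian) (hW : W ∈ unitaryGroup m ℂ) :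
    ‖(W * A).trace‖ ≤ traceNorm A := by
  obtain ⟨U, hU, d, hd, hn⟩ := exists_diagonalization_traceNorm hA
  have hV : Uᴴ * W * U ∈ unitaryGroup m ℂ :=
    mul_mem (mul_mem (Unitary.star_mem hU) hW) hU
  have htr : (W * A).trace = ∑ i, (Uᴴ * W * U) i i * (d i : ℂ) := by
    rw [hd, ← Matrix.mul_assoc, trace_mul_comm, ← Matrix.mul_assoc, ← Matrix.mul_assoc]
    simp [Matrix.trace, mul_diagonal]
  rw [htr, hn]
  refine (norm_sum_le _ _).trans (Finset.sum_le_sum fun i _ => ?_)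
  rw [norm_mul, Complex.norm_real, Real.norm_eq_abs]
  exact mul_le_of_le_one_left (abs_nonneg _) (entry_norm_bound_of_unitary hV i i)

/-! ### Trace distance and fidelity -/

/-- The total variation distance of two probability distributions `a²`, `b²` is bounded in terms of
their Bhattacharyya coefficient `∑ a b`. -/
theorem sq_sum_abs_sq_sub_sq_le {m : Type} [Fintype m] (a b : m → ℝ)
    (ha : ∀ i, 0 ≤ a i) (hb : ∀ i, 0 ≤ b i) (ha1 : ∑ i, a i ^ 2 = 1) (hb1 : ∑ i, b i ^ 2 = 1) :
    (∑ i, |a i ^ 2 - b i ^ 2|) ^ 2 ≤ 4 * (1 - (∑ i, a i * b i) ^ 2) := by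
  have h := Finset.sum_mul_sq_le_sq_mul_sq Finset.univ (fun i => |a i - b i|)
    (fun i => a i + b i)
  have h1 : ∑ i, |a i - b i| ^ 2 = 2 - 2 * ∑ i, a i * b i := by
    simp only [sq_abs, sub_sq, Finset.sum_add_distrib, Finset.sum_sub_distrib, ha1, hb1,
      mul_assoc, ← Finset.mul_sum]
    ring
  have h2 : ∑ i, (a i + b i) ^ 2 = 2 + 2 * ∑ i, a i * b i := by
    simp only [add_sq, Finset.sum_add_distrib, ha1, hb1, mul_assoc, ← Finset.mul_sum]
    ring
  have h3 : ∀ i, |a i ^ 2 - b i ^ 2| = |a i - b i| * (a i + b i) := fun i => by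
    rw [sq_sub_sq, mul_comm, abs_mul, abs_of_nonneg (add_nonneg (ha i) (hb i))]
  simp only [h3]
  rw [h1, h2] at h
  linarith [h]

/-- The Fuchs–van de Graaf inequality for a pure state `ψ`: measuring both states in an eigenbasis
of their difference attains the trace distance and does not decrease the fidelity. -/
theorem sq_traceNorm_ketBra_sub_le {ι : Type} [Fintype ι] [DecidableEq ι] {ψ : Bits ι → ℂ}
    (hψ : star ψ ⬝ᵥ ψ = 1) {ρ : QOp ι} (hρ : IsDensity ρ) :
    traceNorm (ketBra ψ - ρ) ^ 2 ≤ 4 * (1 - (star ψ ⬝ᵥ (ρ *ᵥ ψ)).re) := by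
  have hA : (ketBra ψ - ρ).IsHermitian :=
    (posSemidef_vecMulVec_self_star ψ).isHermitian.sub hρ.1.isHermitian
  obtain ⟨U, hU, d, hd, hn⟩ := exists_diagonalization_traceNorm hA
  obtain ⟨B, rfl⟩ : ∃ B : QOp ι, ρ = Bᴴ * B := by
    open scoped MatrixOrder in
    exact CStarAlgebra.nonneg_iff_eq_star_mul_self.1 hρ.1.nonneg
  have hU1 : Uᴴ * U = 1 := mem_unitaryGroup_iff'.1 hU
  have hU2 : U * Uᴴ = 1 := mem_unitaryGroup_iff.1 hU
  set φ : Bits ι → ℂ := Uᴴ *ᵥ ψ with hφ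
  set M : QOp ι := B * U with hM
  let c : Bits ι → EuclideanSpace ℂ (Bits ι) := fun i => WithLp.toLp 2 (fun k => M k i)
  have hc : ∀ i, ((‖c i‖ ^ 2 : ℝ) : ℂ) = (Mᴴ * M) i i := fun i => by
    rw [EuclideanSpace.norm_sq_eq]
    simp [c, Matrix.mul_apply, Complex.conj_mul']
  have hdiag : vecMulVec φ (star φ) - Mᴴ * M = diagonal (fun i => (d i : ℂ)) := by
    have h1 : Uᴴ * (ketBra ψ - Bᴴ * B) * U = diagonal (fun i => (d i : ℂ)) := by
      rw [hd]
      simp only [← Matrix.mul_assoc, hU1, Matrix.one_mul]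
      rw [Matrix.mul_assoc, hU1, Matrix.mul_one]
    rw [← h1, Matrix.mul_sub, Matrix.sub_mul, ketBra, mul_vecMulVec, vecMulVec_mul, hM, hφ,
      star_mulVec, conjTranspose_mul, conjTranspose_conjTranspose]
    simp only [Matrix.mul_assoc]
  have hd' : ∀ i, d i = ‖φ i‖ ^ 2 - ‖c i‖ ^ 2 := fun i => by
    have h := congrFun (congrFun hdiag i) i
    rw [Matrix.sub_apply, ← hc, vecMulVec_apply, diagonal_apply_eq, Pi.star_apply, RCLike.star_def,
      Complex.mul_conj'] at h
    exact_mod_cast h.symm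
  have hφ1 : ∑ i, ‖φ i‖ ^ 2 = 1 := by
    have h : star φ ⬝ᵥ φ = 1 := by
      rw [hφ, star_mulVec, ← dotProduct_mulVec, mulVec_mulVec, conjTranspose_conjTranspose, hU2,
        one_mulVec, hψ]
    simp only [dotProduct, Pi.star_apply, RCLike.star_def, Complex.conj_mul'] at h
    exact_mod_cast h
  have hc1 : ∑ i, ‖c i‖ ^ 2 = 1 := by
    have h : (Mᴴ * M).trace = 1 := by
      rw [hM, conjTranspose_mul, Matrix.mul_assoc, trace_mul_comm, Matrix.mul_assoc,
        Matrix.mul_assoc, hU2, Matrix.mul_one, hρ.2]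
    simp only [Matrix.trace, diag_apply, ← hc] at h
    exact_mod_cast h
  have hF : (star ψ ⬝ᵥ ((Bᴴ * B) *ᵥ ψ)).re = ‖∑ i, φ i • c i‖ ^ 2 := by
    have h1 : M *ᵥ φ = B *ᵥ ψ := by
      rw [hM, hφ, mulVec_mulVec, Matrix.mul_assoc, hU2, Matrix.mul_one]
    have h2 : ∑ i, φ i • c i = WithLp.toLp 2 (B *ᵥ ψ) := by
      rw [← h1]
      ext k
      simp [c, mulVec, dotProduct, mul_comm]
    have h3 : star ψ ⬝ᵥ ((Bᴴ * B) *ᵥ ψ) = star (B *ᵥ ψ) ⬝ᵥ (B *ᵥ ψ) := by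
      rw [star_mulVec, ← dotProduct_mulVec, mulVec_mulVec]
    rw [h2, h3, EuclideanSpace.norm_sq_eq]
    simp only [dotProduct, Pi.star_apply, RCLike.star_def, Complex.conj_mul']
    norm_cast
  have hle : ‖∑ i, φ i • c i‖ ≤ ∑ i, ‖φ i‖ * ‖c i‖ :=
    (norm_sum_le _ _).trans (Finset.sum_le_sum fun i _ => norm_smul_le _ _)
  have hcl := sq_sum_abs_sq_sub_sq_le (fun i => ‖φ i‖) (fun i => ‖c i‖)
    (fun i => norm_nonneg _) (fun i => norm_nonneg _) hφ1 hc1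
  rw [hn, hF]
  simp only [hd']
  have := pow_le_pow_left₀ (norm_nonneg _) hle 2
  linarith

/-! ### Light cones in an interaction graph -/

/-- `GraphGrowth G v j S`: the set `S` of vertices can be obtained from `{v}` in `j` steps, each of
which adds, for every vertex `p` already present, at most one neighbour `f p` of `p`
(`f p = p` when nothing is added for `p`). -/
inductive GraphGrowth {V : Type} [DecidableEq V] (G : SimpleGraph V) (v : V) :
    ℕ → Finset V → Prop
  | zero : GraphGrowth G v 0 {v}
  | step {j : ℕ} {S : Finset V} (f : V → V) (hf : ∀ p ∈ S, f p = p ∨ G.Adj p (f p))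
      (hS : GraphGrowth G v j S) : GraphGrowth G v (j + 1) (S ∪ S.image f)

namespace GraphGrowth

variable {V : Type} [DecidableEq V] {G : SimpleGraph V} {v : V} {j : ℕ} {S : Finset V}

theorem mono (h : GraphGrowth G v j S) {D : ℕ} (hD : j ≤ D) : GraphGrowth G v D S := by
  induction D, hD using Nat.le_induction with
  | base => exact h
  | succ D _ ih => simpa using ih.step id fun p _ => Or.inl rfl

theorem card_le_two_pow (h : GraphGrowth G v j S) : S.card ≤ 2 ^ j := by
  induction h with
  | zero => simp
  | @step j S f hf hS ih =>
    have h1 := Finset.card_union_le S (S.image f)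
    have h2 : (S.image f).card ≤ S.card := Finset.card_image_le
    rw [pow_succ]
    omega

/-- Translating the sites so that the initial one becomes the origin turns growth on a subset of
the square lattice into growth on the square lattice. -/
theorem latticeGrowth_image {site : V → ℤ × ℤ} (hsite : Function.Injective site)
    (h : GraphGrowth (squareLattice.comap site) v j S) :
    LatticeGrowth j (S.image fun x => site x - site v) := by
  induction h with
  | zero =>
    rw [Finset.image_singleton, sub_self]
    exact LatticeGrowth.zero
  | @step j S f hf hS ih =>
    set t : V → ℤ × ℤ := fun x => site x - site v with ht
    have hinj : Function.Injective t := fun x y hxy => hsite (sub_left_injective hxy)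
    have hcomp : ∀ p, Function.extend t (t ∘ f) id (t p) = t (f p) := fun p => by
      rw [hinj.extend_apply, Function.comp_apply]
    have himage : (S ∪ S.image f).image t =
        S.image t ∪ (S.image t).image (Function.extend t (t ∘ f) id) := by
      rw [Finset.image_union, Finset.image_image, Finset.image_image]
      congr 1
      exact Finset.image_congr fun p _ => (hcomp p).symm
    rw [himage]
    refine ih.step _ fun q hq => ?_
    obtain ⟨p, hp, rfl⟩ := Finset.mem_image.1 hq
    rw [hcomp]
    refine (hf p hp).imp (congrArg t) fun hadj => ?_
    simpa [squareLattice, ht] using hadj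

theorem card_le_gammaTwo {site : V → ℤ × ℤ} (hsite : Function.Injective site)
    (h : GraphGrowth (squareLattice.comap site) v j S) : S.card ≤ gammaTwo j := by
  have hinj : Function.Injective fun x => site x - site v :=
    fun x y hxy => hsite (sub_left_injective hxy)
  exact (gammaTwo_isGreatest j).2
    ⟨_, h.latticeGrowth_image hsite, Finset.card_image_of_injective S hinj⟩

end GraphGrowth

/-- On a chain the first step adds a single vertex, and each further step lengthens the enclosing
interval by at most one at either end. -/
theorem GraphGrowth.card_le_of_pathGraph {n : ℕ} {i : Fin n} {j : ℕ} {S : Finset (Fin n)}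
    (h : GraphGrowth (SimpleGraph.pathGraph n) i j S) (hj : 1 ≤ j) : S.card ≤ 2 * j := by
  have key : (j = 0 ∧ S = {i}) ∨
      ∃ a : ℤ, ∀ x ∈ S, a ≤ ((x : ℕ) : ℤ) ∧ ((x : ℕ) : ℤ) < a + 2 * j := by
    clear hj
    induction h with
    | zero => exact Or.inl ⟨rfl, rfl⟩
    | @step j S f hf hS ih =>
      right
      have hf' : ∀ p ∈ S, (f p : ℕ) = p ∨ (p : ℕ) + 1 = f p ∨ (f p : ℕ) + 1 = p := fun p hp =>
        (hf p hp).imp (congrArg Fin.val) SimpleGraph.pathGraph_adj.1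
      rcases ih with ⟨rfl, rfl⟩ | ⟨a, ha⟩
      · have hi := hf' i (by simp)
        refine ⟨min (i : ℕ) (f i : ℕ), fun x hx => ?_⟩
        simp only [Finset.image_singleton, Finset.mem_union, Finset.mem_singleton] at hx
        rcases hx with rfl | rfl <;> push_cast <;> omega
      · refine ⟨a - 1, fun x hx => ?_⟩
        rcases Finset.mem_union.1 hx with hx | hx
        · have := ha x hx
          push_cast
          omega
        · obtain ⟨p, hp, rfl⟩ := Finset.mem_image.1 hx
          have := ha p hp
          have := hf' p hp
          push_cast
          omega
  rcases key with ⟨rfl, -⟩ | ⟨a, ha⟩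
  · omega
  · have h1 : S.card ≤ (Finset.Ico a (a + 2 * j)).card :=
      Finset.card_le_card_of_injOn (fun x => ((x : ℕ) : ℤ))
        (fun x hx => Finset.mem_coe.2 (Finset.mem_Ico.2 (ha x hx)))
        fun x _ y _ hxy => Fin.ext (Int.ofNat_inj.1 hxy)
    rw [Int.card_Ico] at h1
    omega

/-! ### Operators supported on a set of qubits -/

section Locality

variable {n : ℕ} {s t : Finset (Fin n)}

theorem extendOp_apply (s : Finset (Fin n)) (V : QOp {i // i ∈ s}) (x y : Bits (Fin n)) :
    extendOp s V x y =
      if ∀ i ∉ s, x i = y i then V (fun i => x i) (fun i => y i) else 0 := by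
  have h : (splitBits s x).2 = (splitBits s y).2 ↔ ∀ i ∉ s, x i = y i := by
    simp [splitBits, funext_iff]
  simp only [extendOp, submatrix_apply, kroneckerMap_apply, one_apply, h, mul_ite, mul_one,
    mul_zero]
  rfl

theorem extendOp_one (s : Finset (Fin n)) : extendOp s 1 = 1 := by
  rw [extendOp, one_kronecker_one, submatrix_one_equiv]

theorem extendOp_mul (s : Finset (Fin n)) (V W : QOp {i // i ∈ s}) :
    extendOp s (V * W) = extendOp s V * extendOp s W := by
  rw [extendOp, extendOp, extendOp, submatrix_mul_equiv, ← mul_kronecker_mul, Matrix.mul_one]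

theorem extendOp_conjTranspose (s : Finset (Fin n)) (V : QOp {i // i ∈ s}) :
    extendOp s Vᴴ = (extendOp s V)ᴴ := by
  rw [extendOp, extendOp, conjTranspose_submatrix, conjTranspose_kronecker, conjTranspose_one]

theorem extendOp_injective (s : Finset (Fin n)) : Function.Injective (extendOp s) := by
  intro V W h
  ext x y
  have h' := congrFun (congrFun h ((splitBits s).symm (x, 0))) ((splitBits s).symm (y, 0))
  simpa [extendOp] using h'

theorem extendOp_mem_unitaryGroup_iff {V : QOp {i // i ∈ s}} :
    extendOp s V ∈ unitaryGroup (Bits (Fin n)) ℂ ↔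
      V ∈ unitaryGroup (Bits {i // i ∈ s}) ℂ := by
  rw [mem_unitaryGroup_iff, mem_unitaryGroup_iff, star_eq_conjTranspose, star_eq_conjTranspose,
    ← extendOp_conjTranspose, ← extendOp_mul, ← extendOp_one s, (extendOp_injective s).eq_iff]

/-- The partial trace is dual to the extension of operators by the identity. -/
theorem trace_extendOp_mul (s : Finset (Fin n)) (V : QOp {i // i ∈ s}) (ρ : QOp (Fin n)) :
    (extendOp s V * ρ).trace = (V * marginal s ρ).trace := by
  have h : ρ = (ρ.submatrix (splitBits s).symm (splitBits s).symm).submatrix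
      (splitBits s) (splitBits s) := by
    simp
  conv_lhs => rw [h, extendOp, submatrix_mul_equiv]
  simp only [Matrix.trace, diag_apply, submatrix_apply]
  rw [(splitBits s).sum_comp fun p => (V ⊗ₖ (1 : QOp {i // i ∉ s}) *
    ρ.submatrix (splitBits s).symm (splitBits s).symm) p p, Fintype.sum_prod_type]
  refine Finset.sum_congr rfl fun x _ => ?_
  simp only [Matrix.mul_apply, Fintype.sum_prod_type, kroneckerMap_apply, one_apply, mul_ite,
    mul_one, mul_zero, ite_mul, zero_mul, Finset.sum_ite_eq, Finset.mem_univ, if_true, marginal,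
    submatrix_apply, Finset.mul_sum]
  exact Finset.sum_comm

theorem marginal_sub (s : Finset (Fin n)) (ρ σ : QOp (Fin n)) :
    marginal s (ρ - σ) = marginal s ρ - marginal s σ := by
  ext x y
  simp [marginal, Finset.sum_sub_distrib]

theorem marginal_isHermitian (s : Finset (Fin n)) {ρ : QOp (Fin n)} (hρ : ρ.IsHermitian) :
    (marginal s ρ).IsHermitian := by
  ext x y
  simp only [conjTranspose_apply, marginal, star_sum, hρ.apply]

/-- `IsSupportedOn s A`: the operator `A` is of the form `V ⊗ I` with `V` acting on the qubits
in `s`. -/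
def IsSupportedOn (s : Finset (Fin n)) (A : QOp (Fin n)) : Prop := ∃ V, extendOp s V = A

theorem isSupportedOn_extendOp (s : Finset (Fin n)) (V : QOp {i // i ∈ s}) :
    IsSupportedOn s (extendOp s V) := ⟨V, rfl⟩

namespace IsSupportedOn

variable {A B : QOp (Fin n)}

theorem mono (h : IsSupportedOn s A) (hst : s ⊆ t) : IsSupportedOn t A := by
  obtain ⟨V, rfl⟩ := h
  refine ⟨of fun x y => if ∀ i : {i // i ∈ t}, (i : Fin n) ∉ s → x i = y i then
    V (fun i => x ⟨i, hst i.2⟩) (fun i => y ⟨i, hst i.2⟩) else 0, ?_⟩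
  ext x y
  rw [extendOp_apply, extendOp_apply, of_apply, ← ite_and]
  have h : ((∀ i ∉ t, x i = y i) ∧ ∀ i : {i // i ∈ t}, (i : Fin n) ∉ s → x i = y i) ↔
      ∀ i ∉ s, x i = y i := by
    refine ⟨fun h i hi => ?_, fun h => ⟨fun i hi => h i fun his => hi (hst his),
      fun i hi => h i hi⟩⟩
    by_cases hit : i ∈ t
    exacts [h.2 ⟨i, hit⟩ hi, h.1 i hit]
  exact if_congr h rfl rfl

theorem mul (hA : IsSupportedOn s A) (hB : IsSupportedOn s B) : IsSupportedOn s (A * B) := by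
  obtain ⟨V, rfl⟩ := hA
  obtain ⟨W, rfl⟩ := hB
  exact ⟨V * W, extendOp_mul s V W⟩

theorem conjTranspose (hA : IsSupportedOn s A) : IsSupportedOn s Aᴴ := by
  obtain ⟨V, rfl⟩ := hA
  exact ⟨Vᴴ, extendOp_conjTranspose s V⟩

end IsSupportedOn

theorem extendOp_mul_extendOp_apply (hst : Disjoint s t) (V : QOp {i // i ∈ s})
    (W : QOp {i // i ∈ t}) (x y : Bits (Fin n)) :
    (extendOp s V * extendOp t W) x y = if ∀ i, i ∉ s → i ∉ t → x i = y i then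
      V (fun i => x i) (fun i => y i) * W (fun i => x i) (fun i => y i) else 0 := by
  -- The only intermediate label that contributes agrees with `y` on `s` and with `x` off `s`.
  let z : Bits (Fin n) := fun i => if i ∈ s then y i else x i
  have hzs : ∀ i ∈ s, z i = y i := fun i hi => if_pos hi
  have hzx : ∀ i ∉ s, x i = z i := fun i hi => (if_neg hi).symm
  have hzt : ∀ i ∈ t, z i = x i := fun i hi => if_neg (Finset.disjoint_right.1 hst hi)
  rw [Matrix.mul_apply, Finset.sum_eq_single z]
  · have h1 : (fun i : {i // i ∈ s} => z i) = fun i : {i // i ∈ s} => y i :=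
      funext fun i => hzs i i.2
    have h2 : (fun i : {i // i ∈ t} => z i) = fun i : {i // i ∈ t} => x i :=
      funext fun i => hzt i i.2
    have h3 : (∀ i ∉ t, z i = y i) ↔ ∀ i, i ∉ s → i ∉ t → x i = y i :=
      ⟨fun h i his hit => (hzx i his).trans (h i hit), fun h i hit => by
        by_cases his : i ∈ s
        exacts [hzs i his, (hzx i his).symm.trans (h i his hit)]⟩
    rw [extendOp_apply, extendOp_apply, if_pos hzx, h1, h2, mul_ite, mul_zero]
    exact if_congr h3 rfl rfl
  · intro w _ hw
    rw [extendOp_apply, extendOp_apply]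
    by_contra hne
    obtain ⟨h1, h2⟩ := ne_zero_and_ne_zero_of_mul hne
    have hxw : ∀ i ∉ s, x i = w i := by
      by_contra h
      exact h1 (if_neg h)
    have hwy : ∀ i ∉ t, w i = y i := by
      by_contra h
      exact h2 (if_neg h)
    refine hw (funext fun i => ?_)
    by_cases his : i ∈ s
    · rw [hzs i his, hwy i (Finset.disjoint_left.1 hst his)]
    · rw [← hzx i his, hxw i his]
  · simp

theorem extendOp_commute (hst : Disjoint s t) (V : QOp {i // i ∈ s}) (W : QOp {i // i ∈ t}) :
    extendOp s V * extendOp t W = extendOp t W * extendOp s V := by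
  ext x y
  rw [extendOp_mul_extendOp_apply hst, extendOp_mul_extendOp_apply hst.symm, mul_comm]
  exact if_congr (forall_congr' fun i => by tauto) rfl rfl

theorem extendOp_conj_of_disjoint {V : QOp {i // i ∈ s}}
    (hV : V ∈ unitaryGroup (Bits {i // i ∈ s}) ℂ) {A : QOp (Fin n)} (hA : IsSupportedOn t A)
    (hst : Disjoint s t) : extendOp s V * A * (extendOp s V)ᴴ = A := by
  obtain ⟨W, rfl⟩ := hA
  rw [extendOp_commute hst, Matrix.mul_assoc, ← extendOp_conjTranspose, ← extendOp_mul,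
    ← star_eq_conjTranspose, mem_unitaryGroup_iff.1 hV, extendOp_one, Matrix.mul_one]

end Locality

/-! ### Conjugation by layers and circuits -/

section Circuits

variable {n : ℕ} {G : SimpleGraph (Fin n)}

/-- Conjugating by gates on disjoint sets of qubits enlarges the support of an operator only by the
supports of the gates that meet it. -/
theorem IsSupportedOn.conj_gates {S T : Finset (Fin n)} {A : QOp (Fin n)}
    (hA : IsSupportedOn S A) (hST : S ⊆ T) (gs : List (Gate G))
    (hgs : gs.Pairwise fun g h => Disjoint g.support h.support)
    (hT : ∀ g ∈ gs, ¬ Disjoint g.support S → g.support ⊆ T) :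
    ∃ R ⊆ T, (∀ x ∈ R, x ∈ S ∨ ∃ g ∈ gs, x ∈ g.support) ∧
      IsSupportedOn R ((gs.map fun g => extendOp g.support g.V).prod * A *
        ((gs.map fun g => extendOp g.support g.V).prod)ᴴ) := by
  induction gs with
  | nil => exact ⟨S, hST, fun x hx => Or.inl hx, by simpa using hA⟩
  | cons g gs ih =>
    obtain ⟨hg, hgs'⟩ := List.pairwise_cons.1 hgs
    obtain ⟨R, hRT, hR, hsupp⟩ := ih hgs' fun g' hg' => hT g' (List.mem_cons_of_mem _ hg')
    have hassoc : ∀ E P : QOp (Fin n), E * P * A * (E * P)ᴴ = E * (P * A * Pᴴ) * Eᴴ := by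
      intro E P
      simp only [conjTranspose_mul, Matrix.mul_assoc]
    rw [List.map_cons, List.prod_cons, hassoc]
    by_cases hd : Disjoint g.support S
    · have hdR : Disjoint g.support R := by
        refine Finset.disjoint_left.2 fun x hxg hxR => ?_
        rcases hR x hxR with hx | ⟨g', hg', hx⟩
        exacts [Finset.disjoint_left.1 hd hxg hx, Finset.disjoint_left.1 (hg g' hg') hxg hx]
      refine ⟨R, hRT, fun x hx => (hR x hx).imp_right ?_, ?_⟩
      · rintro ⟨g', hg', hx⟩
        exact ⟨g', List.mem_cons_of_mem _ hg', hx⟩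
      · rwa [extendOp_conj_of_disjoint g.unitary hsupp hdR]
    · refine ⟨g.support ∪ R, Finset.union_subset (hT g List.mem_cons_self hd) hRT,
        fun x hx => ?_, ?_⟩
      · rcases Finset.mem_union.1 hx with hx | hx
        · exact Or.inr ⟨g, List.mem_cons_self, hx⟩
        · refine (hR x hx).imp_right ?_
          rintro ⟨g', hg', hx⟩
          exact ⟨g', List.mem_cons_of_mem _ hg', hx⟩
      · have hE := (isSupportedOn_extendOp g.support g.V).mono
          (Finset.subset_union_left (s₂ := R))
        exact (hE.mul (hsupp.mono Finset.subset_union_right)).mul hE.conjTranspose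

theorem Layer.op_mem_unitaryGroup (L : Layer G) : L.op ∈ unitaryGroup (Bits (Fin n)) ℂ := by
  refine list_prod_mem fun A hA => ?_
  obtain ⟨g, -, rfl⟩ := List.mem_map.1 hA
  exact extendOp_mem_unitaryGroup_iff.2 g.unitary

/-- Two distinct qubits of a gate are adjacent and exhaust its support. -/
theorem Gate.adj_of_mem_support (g : Gate G) {p q : Fin n} (hp : p ∈ g.support)
    (hq : q ∈ g.support) (hpq : q ≠ p) : G.Adj p q ∧ ∀ x ∈ g.support, x = p ∨ x = q := by
  rcases g.allowed with ⟨i, j, hij, h⟩ | ⟨i, h⟩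
  · rw [h] at hp hq ⊢
    simp only [Finset.mem_insert, Finset.mem_singleton] at hp hq ⊢
    rcases hp with rfl | rfl <;> rcases hq with rfl | rfl
    · exact absurd rfl hpq
    · exact ⟨hij, fun x hx => hx⟩
    · exact ⟨hij.symm, fun x hx => hx.symm⟩
    · exact absurd rfl hpq
  · rw [h, Finset.mem_singleton] at hp hq
    exact absurd (hq.trans hp.symm) hpq

open Classical in
/-- The function sending a qubit to the other qubit of the gate of the layer that acts on it (and
to itself if there is none). -/
noncomputable def Layer.partner (L : Layer G) (p : Fin n) : Fin n :=
  if h : ∃ q, q ≠ p ∧ ∃ g ∈ L.gates, p ∈ g.support ∧ q ∈ g.support then h.choose else p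

theorem Layer.partner_eq_or_adj (L : Layer G) (p : Fin n) :
    L.partner p = p ∨ G.Adj p (L.partner p) := by
  unfold Layer.partner
  split_ifs with h
  · obtain ⟨hne, g, -, hp, hq⟩ := h.choose_spec
    exact Or.inr (g.adj_of_mem_support hp hq hne).1
  · exact Or.inl rfl

theorem Layer.eq_or_eq_partner (L : Layer G) {g : Gate G} (hg : g ∈ L.gates) {p x : Fin n}
    (hp : p ∈ g.support) (hx : x ∈ g.support) : x = p ∨ x = L.partner p := by
  refine or_iff_not_imp_left.2 fun hxp => ?_
  have h : ∃ q, q ≠ p ∧ ∃ g ∈ L.gates, p ∈ g.support ∧ q ∈ g.support :=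
    ⟨x, hxp, g, hg, hp, hx⟩
  rw [Layer.partner, dif_pos h]
  obtain ⟨hne, g', hg', hp', hq'⟩ := h.choose_spec
  have hgg : g = g' := by
    by_contra hne'
    have : Std.Symm fun g h : Gate G => Disjoint g.support h.support := ⟨fun _ _ h => h.symm⟩
    have : Disjoint g.support g'.support := L.disjoint.forall hg hg' hne'
    exact Finset.disjoint_left.1 this hp hp'
  subst hgg
  exact ((g.adj_of_mem_support hp hq' hne).2 x hx).resolve_left hxp

/-- In the Heisenberg picture, a layer spreads the support of an operator by one step of graph
growth. -/
theorem IsSupportedOn.conj_layer {S : Finset (Fin n)} {A : QOp (Fin n)}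
    (hA : IsSupportedOn S A) (L : Layer G) :
    IsSupportedOn (S ∪ S.image L.partner) (L.op * A * L.opᴴ) := by
  obtain ⟨R, hR, -, h⟩ := hA.conj_gates Finset.subset_union_left L.gates L.disjoint
    (T := S ∪ S.image L.partner) fun g hg hd x hx => by
      obtain ⟨p, hp, hpS⟩ := Finset.not_disjoint_iff.1 hd
      rcases L.eq_or_eq_partner hg hp hx with rfl | rfl
      · exact Finset.mem_union_left _ hpS
      · exact Finset.mem_union_right _ (Finset.mem_image_of_mem _ hpS)
  exact h.mono hR

/-- The operator that a circuit applies to its input. -/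
noncomputable def Circuit.op (C : Circuit G) : QOp (Fin n) :=
  List.foldl (fun U L => L.op * U) 1 C

theorem Circuit.op_nil : Circuit.op ([] : Circuit G) = 1 := rfl

theorem Circuit.op_cons (L : Layer G) (C : Circuit G) :
    Circuit.op (L :: C) = Circuit.op C * L.op := by
  have h : ∀ (C : Circuit G) (U : QOp (Fin n)),
      List.foldl (fun U L => L.op * U) U C = Circuit.op C * U := by
    intro C
    induction C with
    | nil => intro U; simp [Circuit.op]
    | cons L C ih =>
      intro U
      rw [Circuit.op, List.foldl_cons, List.foldl_cons, ih, ih, Matrix.mul_one, Matrix.mul_assoc]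
  rw [Circuit.op, List.foldl_cons, h, Matrix.mul_one]

theorem Circuit.output_eq (C : Circuit G) : C.output = C.op *ᵥ ketZero n := by
  have h : ∀ (C : Circuit G) (v : Bits (Fin n) → ℂ),
      List.foldl (fun v L => L.op *ᵥ v) v C = Circuit.op C *ᵥ v := by
    intro C
    induction C with
    | nil => intro v; simp [Circuit.op_nil]
    | cons L C ih => intro v; rw [List.foldl_cons, ih, Circuit.op_cons, mulVec_mulVec]
  exact h C _

theorem Circuit.op_mem_unitaryGroup (C : Circuit G) :
    C.op ∈ unitaryGroup (Bits (Fin n)) ℂ := by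
  induction C with
  | nil => exact one_mem _
  | cons L C ih =>
    rw [Circuit.op_cons]
    exact mul_mem ih L.op_mem_unitaryGroup

/-- The light cone of an operator under a circuit. -/
theorem IsSupportedOn.conj_circuit {i : Fin n} (C : Circuit G) :
    ∀ {j : ℕ} {S : Finset (Fin n)} {A : QOp (Fin n)}, IsSupportedOn S A → GraphGrowth G i j S →
      ∃ T, GraphGrowth G i (j + C.depth) T ∧ IsSupportedOn T (C.op * A * C.opᴴ) := by
  induction C with
  | nil =>
    intro j S A hA hS
    exact ⟨S, hS, by simpa [Circuit.op_nil] using hA⟩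
  | cons L C ih =>
    intro j S A hA hS
    obtain ⟨T, hT, h⟩ := ih (hA.conj_layer L) (hS.step L.partner fun p _ => L.partner_eq_or_adj p)
    refine ⟨T, ?_, ?_⟩
    · rwa [add_assoc, add_comm 1] at hT
    · rw [Circuit.op_cons, conjTranspose_mul]
      simpa only [Matrix.mul_assoc] using h

end Circuits

/-! ### Pauli observables and robustness -/

section Robustness

variable {n : ℕ}

/-- The Pauli `Z` operator on the qubit `i`. -/
noncomputable def pauliZ (i : Fin n) : QOp (Fin n) := diagonal fun x => if x i = 0 then 1 else -1

theorem pauliZ_mem_unitaryGroup (i : Fin n) : pauliZ i ∈ unitaryGroup (Bits (Fin n)) ℂ := by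
  rw [mem_unitaryGroup_iff, star_eq_conjTranspose, pauliZ, diagonal_conjTranspose,
    diagonal_mul_diagonal, ← diagonal_one]
  congr 1
  ext x
  by_cases h : x i = 0 <;> simp [h]

theorem isSupportedOn_pauliZ (i : Fin n) : IsSupportedOn {i} (pauliZ i) := by
  refine ⟨diagonal fun x => if x ⟨i, Finset.mem_singleton_self i⟩ = 0 then 1 else -1, ?_⟩
  ext x y
  rw [extendOp_apply, pauliZ]
  by_cases hxy : x = y
  · subst hxy
    simp
  · rw [diagonal_apply_ne _ hxy]
    refine ite_eq_right_iff.2 fun h => diagonal_apply_ne _ fun h' => hxy (funext fun j => ?_)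
    by_cases hj : j ∈ ({i} : Finset (Fin n))
    exacts [congrFun h' ⟨j, hj⟩, h j hj]

theorem pauliZ_mulVec_ketZero (i : Fin n) : pauliZ i *ᵥ ketZero n = ketZero n := by
  simp [pauliZ, ketZero]

/-- Union bound: if the all-zero outcome is not observed, then some qubit is observed in the
state `1`. -/
theorem one_sub_apply_zero_le {σ : QOp (Fin n)} (hσ : IsDensity σ) :
    1 - (σ 0 0).re ≤ ∑ i, (1 - (pauliZ i * σ).trace.re) / 2 := by
  have hpos : ∀ x, 0 ≤ (σ x x).re := fun x => (Complex.le_def.1 (hσ.1.diag_nonneg (i := x))).1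
  have htr : ∑ x, (σ x x).re = 1 := by
    simpa [Matrix.trace] using congrArg Complex.re hσ.2
  have hZ : ∀ i, (1 - (pauliZ i * σ).trace.re) / 2 =
      ∑ x : Bits (Fin n), if x i = 0 then 0 else (σ x x).re := fun i => by
    rw [← htr, Matrix.trace, Complex.re_sum, ← Finset.sum_sub_distrib, Finset.sum_div]
    refine Finset.sum_congr rfl fun x _ => ?_
    rw [diag_apply, pauliZ, diagonal_mul]
    split_ifs <;> simp
  simp only [hZ]
  rw [Finset.sum_comm, ← htr, ← Finset.sum_erase_eq_sub (Finset.mem_univ _)]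
  refine (Finset.sum_le_sum fun x hx => ?_).trans (Finset.sum_le_univ_sum_of_nonneg fun x =>
    Finset.sum_nonneg fun i _ => by split_ifs <;> simp [hpos])
  obtain ⟨i, hi⟩ := Function.ne_iff.1 (Finset.ne_of_mem_erase hx)
  have h := Finset.single_le_sum (f := fun i => if x i = 0 then 0 else (σ x x).re)
    (fun j _ => by split_ifs <;> simp [hpos]) (Finset.mem_univ i)
  simpa only [if_neg (show ¬ x i = 0 from hi)] using h

theorem IsDensity.conj {ι : Type} [Fintype ι] [DecidableEq ι] {ρ : QOp ι} (hρ : IsDensity ρ)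
    {U : QOp ι} (hU : U ∈ unitaryGroup (Bits ι) ℂ) : IsDensity (Uᴴ * ρ * U) := by
  refine ⟨hρ.1.conjTranspose_mul_mul_same U, ?_⟩
  rw [trace_mul_comm, ← Matrix.mul_assoc, ← star_eq_conjTranspose, mem_unitaryGroup_iff.1 hU,
    Matrix.one_mul, hρ.2]

/-- The infidelity with `U |0…0⟩` is bounded by the energy of the frustration-free Hamiltonian
`∑ i, (1 - U Z_i U†) / 2`, whose unique ground state is `U |0…0⟩`. -/
theorem infidelity_le_sum {U ρ : QOp (Fin n)} (hU : U ∈ unitaryGroup (Bits (Fin n)) ℂ)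
    (hρ : IsDensity ρ) :
    1 - (star (U *ᵥ ketZero n) ⬝ᵥ (ρ *ᵥ (U *ᵥ ketZero n))).re ≤
      ∑ i, (1 - (U * pauliZ i * Uᴴ * ρ).trace.re) / 2 := by
  have h1 : star (U *ᵥ ketZero n) ⬝ᵥ (ρ *ᵥ (U *ᵥ ketZero n)) = (Uᴴ * ρ * U) 0 0 := by
    rw [star_mulVec, ← dotProduct_mulVec, mulVec_mulVec, mulVec_mulVec]
    have h : star (ketZero n) = Pi.single 0 1 := by
      ext x
      by_cases hx : x = 0 <;> simp [ketZero, ← Pi.zero_def, hx]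
    rw [h]
    simp [ketZero, ← Pi.zero_def]
  have h2 : ∀ i, (U * pauliZ i * Uᴴ * ρ).trace = (pauliZ i * (Uᴴ * ρ * U)).trace := fun i => by
    rw [Matrix.mul_assoc, Matrix.mul_assoc U, trace_mul_comm, Matrix.mul_assoc, Matrix.mul_assoc]
  simp only [h1, h2]
  exact one_sub_apply_zero_le (hρ.conj hU)

/-- A state is robustly determined by its marginals on `k` qubits as soon as it arises from
`|0…0⟩` by a unitary that spreads single-qubit operators to at most `k` qubits. -/
theorem traceNorm_lt_or_exists_marginal {U : QOp (Fin n)}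
    (hU : U ∈ unitaryGroup (Bits (Fin n)) ℂ) {k : ℕ}
    (hloc : ∀ i, ∃ S : Finset (Fin n), S.card ≤ k ∧ IsSupportedOn S (U * pauliZ i * Uᴴ))
    {ρ : QOp (Fin n)} (hρ : IsDensity ρ) {ε : ℝ} (hε : 0 < ε) :
    traceNorm (ketBra (U *ᵥ ketZero n) - ρ) < ε ∨
      ∃ s : Finset (Fin n), s.card = min k n ∧ ε ^ 2 / (4 * (n : ℝ)) <
        traceNorm (marginal s (ketBra (U *ᵥ ketZero n)) - marginal s ρ) := by
  by_contra! h
  obtain ⟨hfar, hclose⟩ := h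
  have hU1 : Uᴴ * U = 1 := mem_unitaryGroup_iff'.1 hU
  set ψ := U *ᵥ ketZero n with hψ
  have hψ1 : star ψ ⬝ᵥ ψ = 1 := by
    rw [hψ, star_mulVec, ← dotProduct_mulVec, mulVec_mulVec, hU1, one_mulVec]
    simp [ketZero]
  have hherm : (ketBra ψ).IsHermitian := (posSemidef_vecMulVec_self_star ψ).isHermitian
  have hlocal : ∀ i, 1 - (U * pauliZ i * Uᴴ * ρ).trace.re ≤ ε ^ 2 / (4 * (n : ℝ)) := by
    intro i
    obtain ⟨S, hSk, hS⟩ := hloc i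
    obtain ⟨s, hSs, hs⟩ := Finset.exists_superset_card_eq
      (le_min hSk (by simpa using S.card_le_univ)) (by simp : min k n ≤ Fintype.card (Fin n))
    have hWU : U * pauliZ i * Uᴴ ∈ unitaryGroup (Bits (Fin n)) ℂ :=
      mul_mem (mul_mem hU (pauliZ_mem_unitaryGroup i)) (Unitary.star_mem hU)
    have hWψ : (U * pauliZ i * Uᴴ) *ᵥ ψ = ψ := by
      rw [hψ, mulVec_mulVec, Matrix.mul_assoc, hU1, Matrix.mul_one, ← mulVec_mulVec,
        pauliZ_mulVec_ketZero]
    obtain ⟨V, hV⟩ := hS.mono hSs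
    have hW1 : (U * pauliZ i * Uᴴ * ketBra ψ).trace = 1 := by
      rw [ketBra, mul_vecMulVec, hWψ, trace_vecMulVec, dotProduct_comm, hψ1]
    have hVU : V ∈ unitaryGroup (Bits {i // i ∈ s}) ℂ :=
      extendOp_mem_unitaryGroup_iff.1 (hV ▸ hWU)
    calc 1 - (U * pauliZ i * Uᴴ * ρ).trace.re
        = (V * (marginal s (ketBra ψ) - marginal s ρ)).trace.re := by
          rw [← marginal_sub, ← trace_extendOp_mul, hV, Matrix.mul_sub, trace_sub, hW1,
            Complex.sub_re, Complex.one_re]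
      _ ≤ traceNorm (marginal s (ketBra ψ) - marginal s ρ) :=
          (Complex.re_le_norm _).trans (norm_trace_unitary_mul_le_traceNorm
            ((marginal_isHermitian s hherm).sub (marginal_isHermitian s hρ.1.isHermitian)) hVU)
      _ ≤ ε ^ 2 / (4 * (n : ℝ)) := hclose s hs
  have hfid := infidelity_le_sum hU hρ
  have hsum : ∑ i, (1 - (U * pauliZ i * Uᴴ * ρ).trace.re) / 2 ≤ ε ^ 2 / 8 := by
    refine (Finset.sum_le_sum fun i _ => div_le_div_of_nonneg_right (hlocal i)
      zero_le_two).trans ?_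
    rw [Finset.sum_const, Finset.card_univ, Fintype.card_fin, nsmul_eq_mul]
    -- Without qubits, the left-hand side is an empty sum.
    rcases Nat.eq_zero_or_pos n with rfl | hn
    · simp only [Nat.cast_zero, zero_mul]
      positivity
    · have : (n : ℝ) ≠ 0 := by positivity
      apply le_of_eq
      field_simp
      norm_num
  have hFvdG := sq_traceNorm_ketBra_sub_le hψ1 hρ
  have hsq := pow_le_pow_left₀ hε.le hfar 2
  have := pow_pos hε 2
  linarith

end Robustness

theorem exists_circuit_of_circuitComplexity_le {n D : ℕ} {G : SimpleGraph (Fin n)}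
    {ψ : Bits (Fin n) → ℂ} (h : circuitComplexity G ψ ≤ D) :
    ∃ C : Circuit G, C.output = ψ ∧ C.depth ≤ D := by
  by_contra! hC
  have : ((D + 1 : ℕ) : ℕ∞) ≤ circuitComplexity G ψ :=
    le_iInf₂ fun C hψ => by exact_mod_cast hC C hψ
  have := this.trans h
  norm_cast at this
  omega

/-- A bound on the size of the sets grown in `D` steps bounds the number of qubits of the marginals
that determine the outputs of circuits of depth `D`. -/
theorem traceNorm_lt_or_exists_marginal_of_circuitComplexity_le {n D k : ℕ}
    {G : SimpleGraph (Fin n)} {ψ : Bits (Fin n) → ℂ} (hψ : circuitComplexity G ψ ≤ D)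
    (hk : ∀ i S, GraphGrowth G i D S → S.card ≤ k) {ρ : QOp (Fin n)} (hρ : IsDensity ρ)
    {ε : ℝ} (hε : 0 < ε) :
    traceNorm (ketBra ψ - ρ) < ε ∨
      ∃ s : Finset (Fin n), s.card = min k n ∧
        ε ^ 2 / (4 * (n : ℝ)) < traceNorm (marginal s (ketBra ψ) - marginal s ρ) := by
  obtain ⟨C, rfl, hC⟩ := exists_circuit_of_circuitComplexity_le hψ
  rw [C.output_eq]
  refine traceNorm_lt_or_exists_marginal C.op_mem_unitaryGroup (fun i => ?_) hρ hε
  obtain ⟨T, hT, h⟩ := (isSupportedOn_pauliZ i).conj_circuit C (GraphGrowth.zero (G := G))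
  exact ⟨T, hk i T (hT.mono (by omega)), h⟩

theorem mainTheorem1 (n D k : ℕ) (ψ : Bits (Fin n) → ℂ)
    (hk :
      -- unrestricted two-qubit gates
      (circuitComplexity (⊤ : SimpleGraph (Fin n)) ψ ≤ D ∧ k = 2 ^ D) ∨
      -- one-dimensional chain
      (1 ≤ D ∧ circuitComplexity (SimpleGraph.pathGraph n) ψ ≤ D ∧ k = 2 * D) ∨
      -- qubits placed on distinct sites of the square lattice
      (∃ site : Fin n → ℤ × ℤ, Function.Injective site ∧
        circuitComplexity (squareLattice.comap site) ψ ≤ D ∧ k = gammaTwo D))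
    (ρ : QOp (Fin n)) (hρ : IsDensity ρ) (ε : ℝ) (hε : 0 < ε) :
    traceNorm (ketBra ψ - ρ) < ε ∨
      ∃ s : Finset (Fin n), s.card = min k n ∧
        ε ^ 2 / (4 * (n : ℝ)) < traceNorm (marginal s (ketBra ψ) - marginal s ρ) := by
  rcases hk with ⟨hψ, rfl⟩ | ⟨hD, hψ, rfl⟩ | ⟨site, hsite, hψ, rfl⟩
  · exact traceNorm_lt_or_exists_marginal_of_circuitComplexity_le hψ
      (fun i S h => h.card_le_two_pow) hρ hε
  · exact traceNorm_lt_or_exists_marginal_of_circuitComplexity_le hψ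
      (fun i S h => h.card_le_of_pathGraph hD) hρ hε
  · exact traceNorm_lt_or_exists_marginal_of_circuitComplexity_le hψ
      (fun i S h => h.card_le_gammaTwo hsite) hρ hε
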